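/- For positive integers $n$ and $d$, let $A_2(n,d)$ denote the maximum number of codewords in a binary code $C\subseteq\mathbb{F}_2^n$ of length $n$ and minimum distance $d$ (that is, any two distinct codewords of $C$ are at Hamming distance at least $d$), and let $V(n,r)=\sum_{i=0}^{r}\binom{n}{i}$ denote the volume of a Hamming sphere of radius $r$ in $\mathbb{F}_2^n$. Then there exists an absolute constant $c>0$ such that for all positive integers $n$ and $d$ with $d/n\le 0.499$, $$A_2(n,d)\ \ge\ c\,\frac{2^n}{V(n,d-1)}\,\log_2 V(n,d-1).$$ -/

import Mathlib

namespace BinaryCode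

/-- A binary code `C ⊆ 𝔽₂ⁿ` has minimum distance (at least) `d`: any two distinct codewords
are at Hamming distance at least `d`. -/
def HasMinDist {n : ℕ} (d : ℕ) (C : Finset (Fin n → ZMod 2)) : Prop :=
  ∀ x ∈ C, ∀ y ∈ C, x ≠ y → d ≤ hammingDist x y

/-- `A₂(n,d)`: the maximum number of codewords of a binary code of length `n` and
minimum distance `d`. -/
noncomputable def A₂ (n d : ℕ) : ℕ :=
  sSup {m : ℕ | ∃ C : Finset (Fin n → ZMod 2), HasMinDist d C ∧ C.card = m}

/-- `V(n,r) = ∑_{i=0}^{r} (n choose i)`: the volume of a Hamming sphere of radius `r` in `𝔽₂ⁿ`. -/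
def V (n r : ℕ) : ℕ := ∑ i ∈ Finset.range (r + 1), n.choose i

/-- The supremum defining `A₂(n,d)` is an attained maximum. -/
theorem isGreatest_A₂ (n d : ℕ) :
    IsGreatest {m : ℕ | ∃ C : Finset (Fin n → ZMod 2), HasMinDist d C ∧ C.card = m} (A₂ n d) := by
  have hb : BddAbove {m : ℕ | ∃ C : Finset (Fin n → ZMod 2), HasMinDist d C ∧ C.card = m} := by
    refine ⟨Fintype.card (Fin n → ZMod 2), ?_⟩
    rintro m ⟨C, -, rfl⟩
    exact Finset.card_le_univ C
  have hn : {m : ℕ | ∃ C : Finset (Fin n → ZMod 2), HasMinDist d C ∧ C.card = m}.Nonempty :=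
    ⟨0, ∅, by simp [HasMinDist], rfl⟩
  exact ⟨Nat.sSup_mem hn hb, fun m hm => le_csSup hb hm⟩

end BinaryCode

/-! Codes of minimum distance `r + 1` are the independent sets of the graph joining distinct words
at distance at most `r`, whose degrees are at most `V n r`. Greedy choice gives `2 ^ n / V n r`; the
logarithm is gained because neighbourhoods are sparse.

Draw an independent set from the hard-core model. Conditioned on its trace outside the closed
neighbourhood of `v`, either few neighbours of `v` remain available, so `v` itself is likely to be
chosen, or many remain, and sparsity makes many of them chosen. Averaging over `v` (`exists_indep`)
gives a set of size at least `m / (2 * D)` times the number of vertices, with `m` of order `log (D /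
√T)`, where `D` bounds degrees and `T` bounds ordered adjacent pairs in a neighbourhood.

It remains to save a power: `T ≤ exp C * V ^ (2 - e)` (`exists_triangle_exponent`). Two random words
of weight about `p * n`, `p < 1 / 2`, are typically farther apart than `p * n`; the saving is a
relative entropy, bounded below by compactness away from `p = 0`, while small `p` is estimated
directly. -/

namespace HardCore

/-! ### The hard-core model on a sparse set -/

open Finset

open scoped Classical in
/-- The independent sets of `G` contained in `X`. -/
noncomputable def indepSets {α : Type*} (G : SimpleGraph α) (X : Finset α) : Finset (Finset α) :=
  X.powerset.filter fun J => ∀ a ∈ J, ∀ b ∈ J, ¬ G.Adj a b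

/-- The hard-core partition function of `G` restricted to `X`, at fugacity `l`. -/
noncomputable def partitionFn {α : Type*} (G : SimpleGraph α) (l : ℝ) (X : Finset α) : ℝ :=
  ∑ J ∈ indepSets G X, l ^ #J

/-- The unnormalised expected size of a hard-core random independent subset of `X`. -/
noncomputable def occupancy {α : Type*} (G : SimpleGraph α) (l : ℝ) (X : Finset α) : ℝ :=
  ∑ J ∈ indepSets G X, l ^ #J * #J

section
open scoped Classical

variable {α : Type*} {G : SimpleGraph α} {l : ℝ} {X : Finset α}

theorem mem_indepSets {J : Finset α} :
    J ∈ indepSets G X ↔ J ⊆ X ∧ ∀ a ∈ J, ∀ b ∈ J, ¬ G.Adj a b := by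
  simp [indepSets]

theorem empty_mem_indepSets : ∅ ∈ indepSets G X := by simp [mem_indepSets]

theorem one_le_partitionFn (hl : 0 ≤ l) : 1 ≤ partitionFn G l X := by
  have := single_le_sum (f := fun J : Finset α => l ^ #J) (fun J _ => pow_nonneg hl _)
    (empty_mem_indepSets (G := G) (X := X))
  simpa [partitionFn] using this

theorem partitionFn_le_exp (hl : 0 ≤ l) : partitionFn G l X ≤ Real.exp (l * #X) := by
  calc partitionFn G l X ≤ ∑ J ∈ X.powerset, l ^ #J :=
        sum_le_sum_of_subset_of_nonneg (filter_subset _ _) fun _ _ _ => pow_nonneg hl _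
    _ = (l + 1) ^ #X := by
        have := Finset.sum_pow_mul_eq_add_pow l 1 X
        simpa using this
    _ ≤ Real.exp l ^ #X := by gcongr; exact Real.add_one_le_exp l
    _ = Real.exp (l * #X) := by rw [← Real.exp_nat_mul, mul_comm]

theorem sum_mem_eq {u : α} (hu : u ∈ X) :
    ∑ J ∈ indepSets G X with u ∈ J, l ^ #J =
      l * ∑ J ∈ indepSets G X with u ∉ J ∧ ∀ w ∈ J, ¬ G.Adj u w, l ^ #J := by
  rw [mul_sum]
  refine sum_nbij' (fun J => J.erase u) (fun J => insert u J) ?_ ?_ ?_ ?_ ?_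
  · intro J hJ
    simp only [mem_filter, mem_indepSets, mem_erase, subset_iff] at hJ ⊢
    grind
  · intro J hJ
    simp only [mem_filter, mem_indepSets, mem_insert, subset_iff] at hJ ⊢
    obtain ⟨⟨h1, h2⟩, h3, h4⟩ := hJ
    refine ⟨⟨by grind, ?_⟩, by simp⟩
    rintro a (rfl | ha) b (rfl | hb)
    · exact G.loopless.irrefl _
    · exact h4 b hb
    · exact fun h => h4 a ha h.symm
    · exact h2 a ha b hb
  · intro J hJ
    simp only [mem_filter] at hJ
    exact insert_erase hJ.2
  · intro J hJ
    simp only [mem_filter] at hJ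
    exact erase_insert hJ.2.1
  · intro J hJ
    simp only [mem_filter] at hJ
    rw [← card_erase_add_one hJ.2, pow_succ, mul_comm]

theorem sum_mem_le {u : α} (hl : 0 ≤ l) (hu : u ∈ X) :
    ∑ J ∈ indepSets G X with u ∈ J, l ^ #J ≤ l * partitionFn G l X := by
  rw [sum_mem_eq hu]
  gcongr
  exact sum_le_sum_of_subset_of_nonneg (filter_subset _ _) fun _ _ _ => pow_nonneg hl _

/-- Union bound: an independent set contains `u`, contains a neighbour of `u`, or admits `u`. Sets
admitting `u` weigh `1 / l` times those containing it, and each neighbour contributes at most `l`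
times the partition function. -/
theorem le_sum_mem {u : α} (hl : 0 ≤ l) (hu : u ∈ X) :
    l * partitionFn G l X * (1 - l * #{w ∈ X | G.Adj u w}) ≤
      (1 + l) * ∑ J ∈ indepSets G X with u ∈ J, l ^ #J := by
  have key : partitionFn G l X ≤
      ∑ J ∈ indepSets G X with u ∉ J ∧ ∀ w ∈ J, ¬ G.Adj u w, l ^ #J +
      ∑ J ∈ indepSets G X with u ∈ J, l ^ #J +
      ∑ w ∈ X with G.Adj u w, ∑ J ∈ indepSets G X with w ∈ J, l ^ #J := by
    simp only [sum_filter (s := indepSets G X)]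
    rw [sum_comm, ← sum_add_distrib, ← sum_add_distrib]
    refine sum_le_sum fun J hJ => ?_
    have hp : 0 ≤ l ^ #J := pow_nonneg hl _
    have hs : 0 ≤ ∑ w ∈ X with G.Adj u w, if w ∈ J then l ^ #J else 0 :=
      sum_nonneg fun w _ => by split_ifs <;> simp [hp]
    by_cases h1 : u ∈ J
    · rw [if_neg fun h => h.1 h1, if_pos h1]
      linarith
    · by_cases h2 : ∀ w ∈ J, ¬ G.Adj u w
      · rw [if_pos ⟨h1, h2⟩, if_neg h1]
        linarith
      · have h3 : ¬ (u ∉ J ∧ ∀ w ∈ J, ¬ G.Adj u w) := fun h => h2 h.2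
        rw [if_neg h3, if_neg h1]
        push Not at h2
        obtain ⟨w, hw, hadj⟩ := h2
        have hw' : w ∈ X.filter fun w => G.Adj u w :=
          mem_filter.2 ⟨(mem_indepSets.1 hJ).1 hw, hadj⟩
        have := single_le_sum (f := fun w => if w ∈ J then l ^ #J else 0)
          (fun w _ => by split_ifs <;> simp [hp]) hw'
        simp only [hw, if_true] at this
        linarith
  have h2 : ∑ w ∈ X with G.Adj u w, ∑ J ∈ indepSets G X with w ∈ J, l ^ #J ≤
      #{w ∈ X | G.Adj u w} * (l * partitionFn G l X) := by
    rw [← nsmul_eq_mul]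
    exact sum_le_card_nsmul _ _ _ fun w hw => sum_mem_le hl (mem_filter.1 hw).1
  have h3 := sum_mem_eq (G := G) (l := l) hu
  have h4 := mul_le_mul_of_nonneg_left (key.trans (add_le_add_right h2 _)) hl
  nlinarith

theorem occupancy_eq_sum :
    occupancy G l X = ∑ u ∈ X, ∑ J ∈ indepSets G X with u ∈ J, l ^ #J := by
  simp only [sum_filter, occupancy]
  rw [sum_comm]
  refine sum_congr rfl fun J hJ => ?_
  rw [← sum_filter, sum_const, nsmul_eq_mul, mul_comm,
    filter_mem_eq_inter, inter_eq_right.2 (mem_indepSets.1 hJ).1]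

/-- A hard-core random independent subset of a sparse set `X` is nearly as large as a binomial
one. -/
theorem le_occupancy {T : ℝ} (hl : 0 ≤ l) (hl1 : l ≤ 1) (hT : l ^ 2 * T ≤ 1)
    (hX : ∑ u ∈ X, (#{w ∈ X | G.Adj u w} : ℝ) ≤ T) :
    partitionFn G l X * (l * #X - 1) ≤ 2 * occupancy G l X := by
  have h := sum_le_sum fun u (hu : u ∈ X) => le_sum_mem (G := G) hl hu
  rw [← mul_sum, ← mul_sum, ← occupancy_eq_sum, sum_sub_distrib, ← mul_sum] at h
  simp only [sum_const, nsmul_eq_mul, mul_one] at h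
  have hZ := one_le_partitionFn (G := G) (X := X) hl
  have ho : 0 ≤ occupancy G l X := sum_nonneg fun J _ => by positivity
  have h5 : l * partitionFn G l X * (l * ∑ u ∈ X, (#{w ∈ X | G.Adj u w} : ℝ)) ≤
      partitionFn G l X := by
    calc _ = partitionFn G l X * (l ^ 2 * ∑ u ∈ X, (#{w ∈ X | G.Adj u w} : ℝ)) := by ring
      _ ≤ partitionFn G l X * (l ^ 2 * T) := by gcongr
      _ ≤ partitionFn G l X * 1 := by gcongr
      _ = _ := mul_one _
  nlinarith

/-- For `X` the available neighbours of `v`, the terms `l` and `partitionFn G l X` weigh the choices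
with and without `v`. A large `X` has large occupancy; a small one has partition function at most
`exp (4 * m + 1)`, which `l * D` beats. -/
theorem local_estimate {T D m : ℝ} (hl : 0 ≤ l) (hl1 : l ≤ 1) (hT : l ^ 2 * T ≤ 1)
    (hX : ∑ u ∈ X, (#{w ∈ X | G.Adj u w} : ℝ) ≤ T) (hm : 0 ≤ m)
    (hD : Real.exp (6 * m + 1) ≤ l * D) :
    m * (l + partitionFn G l X) ≤ l * D + occupancy G l X := by
  have hZ := one_le_partitionFn (G := G) (X := X) hl
  have ho : 0 ≤ occupancy G l X := sum_nonneg fun J _ => by positivity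
  have h1 := le_occupancy hl hl1 hT hX
  by_cases h : 4 * m + 1 ≤ l * #X
  · have h2 : partitionFn G l X * (4 * m) ≤ partitionFn G l X * (l * #X - 1) := by
      gcongr; linarith
    nlinarith [Real.exp_pos (6 * m + 1)]
  · have h2 : partitionFn G l X ≤ Real.exp (4 * m + 1) :=
      (partitionFn_le_exp hl).trans (Real.exp_le_exp.2 (not_le.1 h).le)
    have h3 : 2 * m ≤ Real.exp (2 * m) := by linarith [Real.add_one_le_exp (2 * m)]
    have h4 : Real.exp (6 * m + 1) = Real.exp (2 * m) * Real.exp (4 * m + 1) := by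
      rw [← Real.exp_add]; ring_nf
    have h5 : m * (l + partitionFn G l X) ≤ m * (2 * Real.exp (4 * m + 1)) := by
      gcongr; linarith
    nlinarith [Real.exp_pos (4 * m + 1)]

end

/-! ### From one vertex to the whole graph -/

section
open scoped Classical

variable {α : Type*} [Fintype α] {G : SimpleGraph α} {l : ℝ}

/-- The independent sets with prescribed trace `S` outside the closed neighbourhood of `v`. -/
theorem sum_fiber_eq (v : α) (S : Finset α)
    (hS : S ∈ indepSets G {w | w ≠ v ∧ ¬ G.Adj v w}) (F : Finset α → ℝ) :
    ∑ I ∈ indepSets G univ with I.filter (fun w => w ≠ v ∧ ¬ G.Adj v w) = S, F I =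
      F (insert v S) +
        ∑ J ∈ indepSets G {w | G.Adj v w ∧ ∀ s ∈ S, ¬ G.Adj s w}, F (S ∪ J) := by
  obtain ⟨hS1, hS2⟩ := mem_indepSets.1 hS
  simp only [subset_iff, mem_filter, mem_univ, true_and] at hS1
  have hv : ∀ w ∈ S, w ≠ v ∧ ¬ G.Adj v w := fun w hw => hS1 hw
  rw [← sum_filter_add_sum_filter_not _ (fun I => v ∈ I)]
  congr 1
  · rw [show ((indepSets G univ).filter
        (fun I => I.filter (fun w => w ≠ v ∧ ¬ G.Adj v w) = S)).filter (fun I => v ∈ I) =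
        {insert v S} from ?_, sum_singleton]
    ext I
    simp only [mem_filter, mem_indepSets, mem_singleton, subset_univ, true_and]
    constructor
    · rintro ⟨⟨h1, rfl⟩, h3⟩
      ext w
      simp only [mem_insert, mem_filter]
      grind
    · rintro rfl
      refine ⟨⟨?_, ?_⟩, mem_insert_self _ _⟩
      · simp only [mem_insert]
        rintro a (rfl | ha) b (rfl | hb)
        · exact G.loopless.irrefl _
        · exact (hv b hb).2
        · exact fun h => (hv a ha).2 h.symm
        · exact hS2 a ha b hb
      · ext w
        simp only [mem_insert, mem_filter]
        grind
  · refine sum_nbij' (fun I => I.filter (fun w => G.Adj v w)) (fun J => S ∪ J) ?_ ?_ ?_ ?_ ?_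
    · intro I hI
      simp only [mem_filter, mem_indepSets, true_and, subset_iff, mem_univ] at hI ⊢
      grind
    · intro J hJ
      simp only [mem_filter, mem_indepSets, true_and, subset_iff, mem_univ, mem_union] at hJ ⊢
      refine ⟨⟨⟨fun _ _ => trivial, ?_⟩, ?_⟩, ?_⟩
      · rintro a (ha | ha) b (hb | hb)
        · exact hS2 a ha b hb
        · exact (hJ.1 hb).2 a ha
        · exact fun h => (hJ.1 ha).2 b hb h.symm
        · exact hJ.2 a ha b hb
      · ext w
        simp only [mem_union, mem_filter]
        grind
      · rintro (h | h)
        · exact (hv v h).1 rfl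
        · exact G.loopless.irrefl _ (hJ.1 h).1
    · intro I hI
      simp only [mem_filter] at hI
      ext w
      rw [← hI.1.2]
      simp only [mem_union, mem_filter]
      grind
    · intro J hJ
      simp only [mem_indepSets, subset_iff, mem_filter, mem_univ, true_and] at hJ
      ext w
      simp only [mem_union, mem_filter]
      grind
    · intro I hI
      simp only [mem_filter] at hI
      congr 1
      ext w
      rw [← hI.1.2]
      simp only [mem_union, mem_filter]
      grind

theorem vertex_estimate {T D m : ℝ} (hl : 0 ≤ l) (hl1 : l ≤ 1) (hT : l ^ 2 * T ≤ 1) (v : α)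
    (hv : ∑ u with G.Adj v u, (#{w | G.Adj v w ∧ G.Adj u w} : ℝ) ≤ T) (hm : 0 ≤ m)
    (hD : Real.exp (6 * m + 1) ≤ l * D) :
    m * partitionFn G l univ ≤
      ∑ I ∈ indepSets G univ, l ^ #I * ((if v ∈ I then D else 0) + #{w ∈ I | G.Adj v w}) := by
  have hmaps : ∀ I ∈ indepSets G univ, I.filter (fun w => w ≠ v ∧ ¬ G.Adj v w) ∈
      indepSets G {w | w ≠ v ∧ ¬ G.Adj v w} := by
    intro I hI
    simp only [mem_indepSets, subset_iff, mem_filter, mem_univ] at hI ⊢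
    grind
  -- Condition on the trace `S` outside the closed neighbourhood of `v`; the estimate holds fibre by
  -- fibre.
  rw [partitionFn, ← sum_fiberwise_of_maps_to hmaps, ← sum_fiberwise_of_maps_to hmaps, mul_sum]
  refine sum_le_sum fun S hS => ?_
  rw [sum_fiber_eq v S hS, sum_fiber_eq v S hS]
  obtain ⟨hS1, hS2⟩ := mem_indepSets.1 hS
  simp only [subset_iff, mem_filter, mem_univ, true_and] at hS1
  have hvS : v ∉ S := fun h => (hS1 h).1 rfl
  have hNS : S.filter (fun w => G.Adj v w) = ∅ := filter_eq_empty_iff.2 fun w hw => (hS1 hw).2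
  set X : Finset α := {w | G.Adj v w ∧ ∀ s ∈ S, ¬ G.Adj s w} with hX
  have hJ : ∀ J ∈ indepSets G X, Disjoint S J ∧ v ∉ J ∧ J.filter (fun w => G.Adj v w) = J := by
    intro J hJ
    have h := (mem_indepSets.1 hJ).1
    simp only [hX, subset_iff, mem_filter, mem_univ, true_and] at h
    refine ⟨disjoint_left.2 fun a ha ha' => (hS1 ha).2 (h ha').1,
      fun hvJ => G.loopless.irrefl _ (h hvJ).1, filter_true_of_mem fun w hw => (h hw).1⟩
  have e1 : ∑ J ∈ indepSets G X, l ^ #(S ∪ J) = l ^ #S * partitionFn G l X := by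
    rw [partitionFn, mul_sum]
    exact sum_congr rfl fun J h => by rw [card_union_of_disjoint (hJ J h).1, pow_add]
  have e2 : ∑ J ∈ indepSets G X, l ^ #(S ∪ J) *
      ((if v ∈ S ∪ J then D else 0) + (#{w ∈ S ∪ J | G.Adj v w} : ℝ)) =
      l ^ #S * occupancy G l X := by
    rw [occupancy, mul_sum]
    refine sum_congr rfl fun J h => ?_
    obtain ⟨h1, h2, h3⟩ := hJ J h
    rw [card_union_of_disjoint h1, pow_add, filter_union, hNS, h3]
    simp [hvS, h2, mul_assoc]
  have hsub : ∑ u ∈ X, (#{w ∈ X | G.Adj u w} : ℝ) ≤ T := by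
    refine le_trans ?_ hv
    refine (sum_le_sum_of_subset_of_nonneg (t := univ.filter fun u => G.Adj v u) ?_
      fun _ _ _ => by positivity).trans (sum_le_sum fun u _ => ?_)
    · intro u hu
      simp only [hX, mem_filter, mem_univ, true_and] at hu ⊢
      exact hu.1
    · refine Nat.cast_le.2 (card_le_card fun w hw => ?_)
      simp only [hX, mem_filter, mem_univ, true_and] at hw ⊢
      exact ⟨hw.1.1, hw.2⟩
  rw [e1, e2, card_insert_of_notMem hvS, filter_insert, hNS, if_neg (G.loopless.irrefl v)]
  simp only [mem_insert_self, if_true, card_empty, Nat.cast_zero, add_zero, pow_succ]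
  have := mul_le_mul_of_nonneg_left (local_estimate hl hl1 hT hsub hm hD) (pow_nonneg hl #S)
  linarith

/-- A graph whose neighbourhoods are sparse has a large independent set. -/
theorem exists_indep {T D m : ℝ} (hl : 0 ≤ l) (hl1 : l ≤ 1) (hT : l ^ 2 * T ≤ 1)
    (hdeg : ∀ v, (#{w | G.Adj v w} : ℝ) ≤ D)
    (htri : ∀ v, ∑ u with G.Adj v u, (#{w | G.Adj v w ∧ G.Adj u w} : ℝ) ≤ T) (hm : 0 ≤ m)
    (hD : Real.exp (6 * m + 1) ≤ l * D) :
    ∃ I : Finset α, (∀ a ∈ I, ∀ b ∈ I, ¬ G.Adj a b) ∧ m * Fintype.card α ≤ 2 * D * #I := by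
  by_contra! hcon
  have h := sum_le_sum fun v (_ : v ∈ (univ : Finset α)) =>
    vertex_estimate hl hl1 hT v (htri v) hm hD
  rw [sum_comm, sum_const, card_univ, nsmul_eq_mul] at h
  have hlt : ∑ I ∈ indepSets G univ, ∑ v, l ^ #I *
      ((if v ∈ I then D else 0) + (#{w ∈ I | G.Adj v w} : ℝ)) ≤
      ∑ I ∈ indepSets G univ, l ^ #I * (2 * D * #I) := by
    -- Double counting: each vertex of `I` is counted `D` times as itself and at most `D` times as a
    -- neighbour.
    refine sum_le_sum fun I hI => ?_
    rw [← mul_sum]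
    gcongr
    rw [sum_add_distrib]
    have h1 : ∑ v, (if v ∈ I then D else 0) = #I * D := by
      rw [sum_ite_mem, univ_inter, sum_const, nsmul_eq_mul]
    have h2 : ∑ v, (#{w ∈ I | G.Adj v w} : ℝ) ≤ #I * D := by
      have : ∑ v, (#{w ∈ I | G.Adj v w} : ℝ) = ∑ w ∈ I, (#{v | G.Adj w v} : ℝ) := by
        simp only [card_filter, Nat.cast_sum]
        rw [sum_comm]
        simp only [G.adj_comm]
      rw [this, ← nsmul_eq_mul]
      exact sum_le_card_nsmul _ _ _ fun w _ => hdeg w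
    linarith
  have hs : ∑ I ∈ indepSets G univ, l ^ #I * (2 * D * #I) <
      ∑ I ∈ indepSets G univ, l ^ #I * (m * Fintype.card α) := by
    refine sum_lt_sum (fun I hI => ?_) ⟨∅, empty_mem_indepSets, ?_⟩
    · exact mul_le_mul_of_nonneg_left (hcon I (mem_indepSets.1 hI).2).le (pow_nonneg hl _)
    · have := hcon ∅ (by simp)
      simpa using this
  rw [← sum_mul] at hs
  rw [partitionFn] at h
  nlinarith

end

end HardCore

/-! ### Hamming balls, triangles and the code graph -/

namespace BinaryCode

open Finset

theorem V_pos (n r : ℕ) : 0 < V n r :=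
  lt_of_lt_of_le (by simp) (single_le_sum (f := fun i => n.choose i) (fun _ _ => Nat.zero_le _)
    (mem_range.2 (Nat.succ_pos r)))

theorem choose_le_V (n r : ℕ) : n.choose r ≤ V n r :=
  single_le_sum (f := fun i => n.choose i) (fun _ _ => Nat.zero_le _) (by simp)

theorem V_le_two_pow {n r : ℕ} (h : r ≤ n) : V n r ≤ 2 ^ n := by
  rw [← Nat.sum_range_choose]
  exact sum_le_sum_of_subset (range_subset_range.2 (by omega))

theorem card_ball_le (n r : ℕ) :
    #{x : Fin n → ZMod 2 | hammingNorm x ≤ r} ≤ V n r := by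
  have h : #{x : Fin n → ZMod 2 | hammingNorm x ≤ r} ≤
      #((range (r + 1)).biUnion fun i => powersetCard i (univ : Finset (Fin n))) := by
    refine card_le_card_of_injOn (fun x => univ.filter fun i => x i ≠ 0) ?_ ?_
    · intro x hx
      simp only [coe_filter, mem_univ, true_and, Set.mem_ofPred_eq] at hx
      simp only [coe_biUnion, Set.mem_iUnion, mem_coe, mem_powersetCard, mem_range]
      exact ⟨hammingNorm x, by omega, subset_univ _, rfl⟩
    · intro x _ y _ hxy
      ext i
      have := Finset.ext_iff.1 hxy i
      simp only [mem_filter, mem_univ, true_and] at this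
      revert this
      generalize x i = a
      generalize y i = b
      revert a b
      decide
  refine h.trans (card_biUnion_le.trans ?_)
  simp [V, card_powersetCard]

theorem card_ball_center_le {n : ℕ} (v : Fin n → ZMod 2) (r : ℕ) :
    #{x | hammingDist v x ≤ r} ≤ V n r := by
  refine le_trans (card_le_card_of_injOn (fun x => -v + x) ?_ ?_) (card_ball_le n r)
  · intro x hx
    simpa [hammingDist_eq_hammingNorm] using hx
  · intro x _ y _ h
    simpa using h

/-- The number of pairs spanning with the origin a triangle of diameter at most `r`. -/
def trianglesAtZero (n r : ℕ) : ℕ :=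
  #{p : Fin n → ZMod 2 × ZMod 2 | hammingNorm (fun i => (p i).1) ≤ r ∧
    hammingNorm (fun i => (p i).2) ≤ r ∧
    hammingDist (fun i => (p i).1) (fun i => (p i).2) ≤ r}

theorem trianglesAtZero_pos (n r : ℕ) : 0 < trianglesAtZero n r := by
  refine card_pos.2 ⟨0, ?_⟩
  simp only [mem_filter, mem_univ, true_and]
  have h : hammingNorm (fun _ : Fin n => (0 : ZMod 2)) = 0 := hammingNorm_zero
  simp [h]

theorem pow_hammingNorm {n : ℕ} (x : ℝ) (y : Fin n → ZMod 2) :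
    x ^ hammingNorm y = ∏ i, if y i ≠ 0 then x else 1 := by
  rw [prod_ite, prod_const, prod_const_one, mul_one]
  rfl

theorem pow_hammingDist {n : ℕ} (x : ℝ) (y z : Fin n → ZMod 2) :
    x ^ hammingDist y z = ∏ i, if y i ≠ z i then x else 1 := by
  rw [prod_ite, prod_const, prod_const_one, mul_one]
  rfl

/-- Chernoff bound: weight a pair by `x` to the sum of its three distances, which factors over
coordinates. In one coordinate the four bit pairs have weights `1, x ^ 2, x ^ 2, x ^ 2`. -/
theorem trianglesAtZero_mul_le (n r : ℕ) {x : ℝ} (hx : 0 ≤ x) (hx1 : x ≤ 1) :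
    trianglesAtZero n r * x ^ (3 * r) ≤ (1 + 3 * x ^ 2) ^ n := by
  have hsum : (1 + 3 * x ^ 2) = ∑ a : ZMod 2 × ZMod 2,
      ((if a.1 ≠ 0 then x else 1) * (if a.2 ≠ 0 then x else 1) *
        (if a.1 ≠ a.2 then x else 1)) := by
    rw [Fintype.sum_prod_type]
    simp only [show (univ : Finset (ZMod 2)) = {0, 1} from rfl]
    simp
    ring
  rw [hsum, Fintype.sum_pow, trianglesAtZero, ← nsmul_eq_mul]
  refine le_trans (card_nsmul_le_sum _
    (fun p : Fin n → ZMod 2 × ZMod 2 => ∏ i, ((if (p i).1 ≠ 0 then x else 1) *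
      (if (p i).2 ≠ 0 then x else 1) * (if (p i).1 ≠ (p i).2 then x else 1))) _ ?_)
    (sum_le_sum_of_subset_of_nonneg (filter_subset _ _) ?_)
  · intro p hp
    simp only [mem_filter, mem_univ, true_and] at hp
    rw [prod_mul_distrib, prod_mul_distrib, ← pow_hammingNorm, ← pow_hammingNorm,
      ← pow_hammingDist x (fun i => (p i).1) (fun i => (p i).2), ← pow_add, ← pow_add]
    exact pow_le_pow_of_le_one hx hx1 (by omega)
  · intro p _ _
    exact prod_nonneg fun i _ => by positivity

/-- The graph on `𝔽₂ⁿ` joining distinct words at distance at most `r`. -/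
def codeGraph (n r : ℕ) : SimpleGraph (Fin n → ZMod 2) where
  Adj x y := x ≠ y ∧ hammingDist x y ≤ r
  symm := ⟨fun x y h => ⟨h.1.symm, by rw [hammingDist_comm]; exact h.2⟩⟩
  loopless := ⟨fun _ h => h.1 rfl⟩

open scoped Classical in
theorem codeGraph_degree_le {n r : ℕ} (v : Fin n → ZMod 2) :
    #{w | (codeGraph n r).Adj v w} ≤ V n r := by
  refine le_trans (card_le_card fun w hw => ?_) (card_ball_center_le v r)
  simp only [mem_filter, mem_univ, true_and] at hw ⊢
  exact hw.2

open scoped Classical in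
theorem codeGraph_triangles_le {n r : ℕ} (v : Fin n → ZMod 2) :
    ∑ u with (codeGraph n r).Adj v u,
      #{w | (codeGraph n r).Adj v w ∧ (codeGraph n r).Adj u w} ≤ trianglesAtZero n r := by
  rw [← card_sigma]
  refine card_le_card_of_injOn (fun p i => (-v i + p.1 i, -v i + p.2 i)) ?_ ?_
  · rintro ⟨u, w⟩ h
    simp only [coe_sigma, Set.mem_sigma_iff, coe_filter, mem_univ, true_and,
      Set.mem_ofPred_eq] at h ⊢
    obtain ⟨⟨-, h1⟩, ⟨-, h2⟩, -, h3⟩ := h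
    refine ⟨?_, ?_, ?_⟩
    · rw [hammingDist_eq_hammingNorm] at h1; exact h1
    · rw [hammingDist_eq_hammingNorm] at h2; exact h2
    · rwa [hammingDist_comp (fun i a => -v i + a) fun i a b h => add_left_cancel h]
  · rintro ⟨u, w⟩ _ ⟨u', w'⟩ _ h
    have h1 : u = u' := by
      ext i
      have := congrArg Prod.fst (congrFun h i)
      simpa using this
    have h2 : w = w' := by
      ext i
      have := congrArg Prod.snd (congrFun h i)
      simpa using this
    rw [h1, h2]

theorem card_le_A₂ {n d : ℕ} {C : Finset (Fin n → ZMod 2)} (h : HasMinDist d C) :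
    #C ≤ A₂ n d :=
  (isGreatest_A₂ n d).2 ⟨C, h, rfl⟩

/-- The Gilbert–Varshamov bound. -/
theorem two_pow_le_A₂_mul_V (n r : ℕ) : 2 ^ n ≤ A₂ n (r + 1) * V n r := by
  obtain ⟨C, hC, hcard⟩ := (isGreatest_A₂ n (r + 1)).1
  have hcov : (univ : Finset (Fin n → ZMod 2)) ⊆
      C.biUnion fun c => univ.filter fun x => hammingDist c x ≤ r := by
    intro x _
    by_contra hx
    simp only [mem_biUnion, mem_filter, mem_univ, true_and, not_exists, not_and, not_le] at hx
    have hxC : x ∉ C := fun h => by simpa using hx x h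
    have hmin : HasMinDist (r + 1) (insert x C) := by
      intro a ha b hb hab
      rcases mem_insert.1 ha with rfl | ha'
      · rcases mem_insert.1 hb with rfl | hb'
        · exact absurd rfl hab
        · rw [hammingDist_comm]; exact hx b hb'
      · rcases mem_insert.1 hb with rfl | hb'
        · exact hx a ha'
        · exact hC a ha' b hb' hab
    have := card_le_A₂ hmin
    rw [card_insert_of_notMem hxC] at this
    omega
  have h := (card_le_card hcov).trans card_biUnion_le
  rw [card_univ, Fintype.card_fun, ZMod.card, Fintype.card_fin] at h
  refine h.trans ((sum_le_card_nsmul _ _ _ fun c _ => card_ball_center_le c r).trans ?_)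
  rw [smul_eq_mul, hcard]

theorem A₂_ge_of_triangles (n r : ℕ) {m : ℝ} (hm : 0 ≤ m)
    (h : Real.exp (6 * m + 1) * √(trianglesAtZero n r) ≤ V n r) :
    m * 2 ^ n ≤ 2 * V n r * A₂ n (r + 1) := by
  have hT : (1 : ℝ) ≤ √(trianglesAtZero n r) :=
    Real.one_le_sqrt.2 (by exact_mod_cast trianglesAtZero_pos n r)
  have hT0 : (0 : ℝ) < √(trianglesAtZero n r) := by linarith
  obtain ⟨C, hC, hcard⟩ := HardCore.exists_indep (G := codeGraph n r)
    -- The largest fugacity with `l ^ 2 * T ≤ 1`.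
    (l := (√(trianglesAtZero n r))⁻¹) (T := trianglesAtZero n r) (D := V n r) (m := m)
    (by positivity) (inv_le_one_of_one_le₀ hT)
    (by
      rw [inv_pow, Real.sq_sqrt (by positivity)]
      exact inv_mul_le_one)
    (fun v => by exact_mod_cast codeGraph_degree_le v)
    (fun v => by exact_mod_cast codeGraph_triangles_le v) hm
    (by rw [inv_mul_eq_div, le_div_iff₀ hT0]; exact h)
  have hmin : HasMinDist (r + 1) C := by
    intro a ha b hb hab
    by_contra hlt
    exact hC a ha b hb ⟨hab, by omega⟩
  have h1 : (#C : ℝ) ≤ A₂ n (r + 1) := by exact_mod_cast card_le_A₂ hmin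
  rw [Fintype.card_fun, ZMod.card, Fintype.card_fin] at hcard
  push_cast at hcard
  exact hcard.trans (by gcongr)

end BinaryCode

/-! ### Entropy estimates for the triangle count -/

namespace BinaryCode

open Real

theorem log_trianglesAtZero_le (n r : ℕ) {t : ℝ} (ht : 0 < t) (ht1 : t ≤ 1) :
    log (trianglesAtZero n r) ≤ n * log (1 + 3 * t) - 3 / 2 * r * log t := by
  have h := trianglesAtZero_mul_le n r (sqrt_nonneg t) (sqrt_le_one.2 ht1)
  rw [sq_sqrt ht.le] at h
  have hT : (0 : ℝ) < trianglesAtZero n r := by exact_mod_cast trianglesAtZero_pos n r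
  have hs : 0 < √t := sqrt_pos.2 ht
  have h2 := log_le_log (by positivity) h
  rw [log_mul hT.ne' (by positivity), log_pow, log_pow, log_sqrt ht.le] at h2
  push_cast at h2
  linarith

theorem log_factorial_ge (n : ℕ) : n * log n - n ≤ log (n.factorial) := by
  rcases Nat.eq_zero_or_pos n with rfl | hn
  · simp
  have hn' : (0 : ℝ) < n := by exact_mod_cast hn
  have hf : (0 : ℝ) < n.factorial := by exact_mod_cast n.factorial_pos
  have h := log_le_log (by positivity) (pow_div_factorial_le_exp _ hn'.le n)
  rw [log_exp, log_div (by positivity) hf.ne', log_pow] at h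
  linarith

theorem log_factorial_le {n : ℕ} (hn : 1 ≤ n) :
    log (n.factorial) ≤ (n + 1) * log n - n + 1 := by
  induction n, hn using Nat.le_induction with
  | base => simp
  | succ n hn ih =>
    have hn' : (0 : ℝ) < n := by exact_mod_cast hn
    have hf : (0 : ℝ) < n.factorial := by exact_mod_cast n.factorial_pos
    rw [Nat.factorial_succ, Nat.cast_mul, log_mul (by positivity) hf.ne']
    push_cast
    have h := log_le_sub_one_of_pos (x := (n : ℝ) / (n + 1)) (by positivity)
    rw [log_div (by positivity) (by positivity)] at h
    have h2 : (n : ℝ) / (n + 1) - 1 = -1 / (n + 1) := by field_simp; ring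
    rw [h2] at h
    have h3 : (n + 1) * (log n - log (n + 1)) ≤ -1 := by
      calc (n + 1) * (log n - log (n + 1)) ≤ (n + 1) * (-1 / ((n : ℝ) + 1)) := by gcongr
        _ = -1 := by field_simp
    linarith

theorem log_choose_ge {n r : ℕ} (hr : 1 ≤ r) (hrn : r < n) :
    n * log n - r * log r - (n - r) * log (n - r) - 2 * log n - 2 ≤ log (n.choose r) := by
  have h := Nat.choose_mul_factorial_mul_factorial hrn.le
  have hc : (0 : ℝ) < n.choose r := by exact_mod_cast Nat.choose_pos hrn.le
  have h1 : (0 : ℝ) < r.factorial := by exact_mod_cast r.factorial_pos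
  have h2 : (0 : ℝ) < (n - r).factorial := by exact_mod_cast (n - r).factorial_pos
  have h' : log (n.choose r) + log r.factorial + log (n - r).factorial = log n.factorial := by
    rw [← h]
    push_cast
    rw [log_mul (by positivity) h2.ne', log_mul hc.ne' h1.ne']
  have a := log_factorial_ge n
  have b := log_factorial_le hr
  have c := log_factorial_le (n := n - r) (by omega)
  rw [Nat.cast_sub hrn.le] at c
  have hr' : (0 : ℝ) < r := by exact_mod_cast hr
  have hrn' : (r : ℝ) < n := by exact_mod_cast hrn
  have e1 : log r ≤ log n := log_le_log hr' hrn'.le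
  have e2 : log ((n : ℝ) - r) ≤ log n := log_le_log (by linarith) (by linarith)
  linarith

/-- Twice the binary entropy at `p` minus the entropy of the pair of bits `(y, z)` for which
`y`, `z` and `y + z` all have mean `p`, in the most random way. -/
noncomputable def entropyGap (p : ℝ) : ℝ :=
  -(p / 2) * log p - 2 * (1 - p) * log (1 - p) - log 2 + (1 - 3 / 2 * p) * log (2 - 3 * p)

/-- The gap is the relative entropy of the law `(1 - 3 * p / 2, p / 2, p / 2, p / 2)` with respect
to two independent bits of mean `p`. Gibbs' inequality is strict since `2 * p ≠ 1`. -/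
theorem entropyGap_pos {p : ℝ} (h0 : 0 < p) (h1 : p < 1 / 2) : 0 < entropyGap p := by
  have a : 0 < 1 - p := by linarith
  have b : 0 < 2 - 3 * p := by linarith
  have l1 := log_le_sub_one_of_pos (x := (1 - p) ^ 2 / ((2 - 3 * p) / 2)) (by positivity)
  have l2 := log_le_sub_one_of_pos (x := 2 * (1 - p)) (by positivity)
  have l3 := log_lt_sub_one_of_pos (x := 2 * p) (by positivity) (by linarith)
  rw [log_div (by positivity) (by positivity), log_pow, log_div b.ne' two_ne_zero] at l1
  rw [log_mul two_ne_zero a.ne'] at l2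
  rw [log_mul two_ne_zero h0.ne'] at l3
  have m1 := mul_le_mul_of_nonneg_left l1 (by linarith : 0 ≤ (2 - 3 * p) / 2)
  have e1 : (2 - 3 * p) / 2 * ((1 - p) ^ 2 / ((2 - 3 * p) / 2) - 1) =
      (1 - p) ^ 2 - (2 - 3 * p) / 2 := by field_simp
  rw [e1] at m1
  have m2 := mul_le_mul_of_nonneg_left l2 h0.le
  have m3 := mul_lt_mul_of_pos_left l3 (by linarith : 0 < p / 2)
  push_cast at m1
  unfold entropyGap
  linarith

theorem exists_entropyGap_ge {a b : ℝ} (ha : 0 < a) (hb : b < 1 / 2) :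
    ∃ e > 0, ∀ p ∈ Set.Icc a b, e ≤ entropyGap p := by
  rcases (Set.Icc a b).eq_empty_or_nonempty with h | h
  · exact ⟨1, one_pos, by simp [h]⟩
  have hc : ContinuousOn entropyGap (Set.Icc a b) := by
    unfold entropyGap
    have h1 : ContinuousOn (fun p : ℝ => log p) (Set.Icc a b) :=
      continuousOn_id.log fun p hp => by have := hp.1; simp only [id]; linarith
    have h2 : ContinuousOn (fun p : ℝ => log (1 - p)) (Set.Icc a b) :=
      ContinuousOn.log (by fun_prop) fun p hp => by have := hp.2; linarith
    have h3 : ContinuousOn (fun p : ℝ => log (2 - 3 * p)) (Set.Icc a b) :=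
      ContinuousOn.log (by fun_prop) fun p hp => by have := hp.2; linarith
    fun_prop
  obtain ⟨q, hq, hmin⟩ := isCompact_Icc.exists_isMinOn h hc
  exact ⟨entropyGap q, entropyGap_pos (by linarith [hq.1]) (by linarith [hq.2]),
    fun p hp => hmin hp⟩

/-- The triangle bound for radii that are a small fraction of the length. -/
theorem log_trianglesAtZero_le_of_small {n r : ℕ} (hr : 1 ≤ r) (h : r * exp 20 ≤ n) :
    log (trianglesAtZero n r) ≤ 7 / 4 * log (V n r) := by
  have hr' : (0 : ℝ) < r := by exact_mod_cast hr
  have he : (20 : ℝ) + 1 ≤ exp 20 := add_one_le_exp 20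
  have hrn : (2 * r : ℝ) ≤ n := by nlinarith
  have hn' : (0 : ℝ) < n := by linarith
  have hrn' : 2 * r ≤ n := by exact_mod_cast hrn
  have hq : 20 ≤ log n - log r := by
    rw [← log_div hn'.ne' hr'.ne', le_log_iff_exp_le (by positivity), le_div_iff₀ hr']
    linarith
  -- With `q = log (n / r)`, this gives at most `r * (3 + 3 / 2 * q)`, against `log V ≥ r * (q -
  -- 1)`; `q ≥ 20` suffices for the ratio `7 / 4`.
  have ht := log_trianglesAtZero_le n r (t := r / n) (by positivity)
    ((div_le_one hn').2 (by linarith))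
  have h1 : log (1 + 3 * (r / n)) ≤ 3 * (r / n) := by
    have := log_le_sub_one_of_pos (x := 1 + 3 * ((r : ℝ) / n)) (by positivity)
    linarith
  have h2 : n * log (1 + 3 * ((r : ℝ) / n)) ≤ 3 * r := by
    calc n * log (1 + 3 * ((r : ℝ) / n)) ≤ n * (3 * ((r : ℝ) / n)) := by gcongr
      _ = 3 * r := by field_simp
  rw [log_div hr'.ne' hn'.ne'] at ht
  have hV : r * (log n - log r - log 2) ≤ log (V n r) := by
    have c1 : ((n + 1 - r : ℕ) ^ r : ℝ) / r.factorial ≤ n.choose r := Nat.pow_le_choose r n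
    have c2 : ((n : ℝ) / (2 * r)) ^ r ≤ V n r := by
      calc ((n : ℝ) / (2 * r)) ^ r = ((n : ℝ) / 2) ^ r / (r : ℝ) ^ r := by
            rw [← div_pow, div_div]
        _ ≤ ((n + 1 - r : ℕ) ^ r : ℝ) / r.factorial := by
            have f1 : (r.factorial : ℝ) ≤ (r : ℝ) ^ r := by exact_mod_cast r.factorial_le_pow
            have f2 : (n : ℝ) / 2 ≤ (n + 1 - r : ℕ) := by
              rw [Nat.cast_sub (by omega)]
              push_cast
              linarith
            have f3 : (0 : ℝ) < r.factorial := by exact_mod_cast r.factorial_pos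
            gcongr
        _ ≤ n.choose r := c1
        _ ≤ V n r := by exact_mod_cast choose_le_V n r
    have c3 := log_le_log (by positivity) c2
    rw [log_pow, log_div hn'.ne' (by positivity), log_mul two_ne_zero hr'.ne'] at c3
    linarith
  have l2 : log 2 ≤ 1 := by
    have := log_le_sub_one_of_pos (x := 2) two_pos
    linarith
  nlinarith

theorem log_trianglesAtZero_le_entropyGap {n r : ℕ} (hr : 1 ≤ r) (h : 2 * r < n) :
    log (trianglesAtZero n r) ≤
      2 * log (V n r) + 4 * log n + 4 - n * entropyGap (r / n) := by
  have hr' : (0 : ℝ) < r := by exact_mod_cast hr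
  have h' : (2 * r : ℝ) < n := by exact_mod_cast h
  have hn' : (0 : ℝ) < n := by linarith
  obtain ⟨p, hp⟩ : ∃ p : ℝ, p = r / n := ⟨_, rfl⟩
  have hrp : (r : ℝ) = n * p := by rw [hp]; field_simp
  have hp0 : 0 < p := by rw [hp]; positivity
  have hp1 : p < 1 / 2 := by rw [hp, div_lt_div_iff₀ hn' two_pos]; linarith
  have a : 0 < 1 - p := by linarith
  have b : 0 < 2 - 3 * p := by linarith
  -- This `t` solves `2 * t / (1 + 3 * t) = p`: each bit then has mean `p` in the tilted law.
  have ht := log_trianglesAtZero_le n r (t := p / (2 - 3 * p)) (by positivity)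
    ((div_le_one b).2 (by linarith))
  have e : 1 + 3 * (p / (2 - 3 * p)) = 2 / (2 - 3 * p) := by field_simp; ring
  rw [e, log_div two_ne_zero b.ne', log_div hp0.ne' b.ne'] at ht
  have hc := log_choose_ge hr (by omega : r < n)
  have hcV : log (n.choose r) ≤ log (V n r) :=
    log_le_log (by exact_mod_cast Nat.choose_pos (by omega)) (by exact_mod_cast choose_le_V n r)
  have er : log (r : ℝ) = log n + log p := by rw [hrp, log_mul hn'.ne' hp0.ne']
  have enr : log ((n : ℝ) - r) = log n + log (1 - p) := by
    rw [hrp, ← log_mul hn'.ne' a.ne']; ring_nf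
  rw [er, enr, hrp] at hc
  rw [hrp] at ht
  rw [← hp]
  unfold entropyGap
  linarith

theorem exists_triangle_exponent :
    ∃ e C : ℝ, 0 < e ∧ ∀ n r : ℕ, 1 ≤ r → (r : ℝ) ≤ 0.499 * n →
      log (trianglesAtZero n r) ≤ (2 - e) * log (V n r) + C := by
  obtain ⟨g, hg, hgap⟩ := exists_entropyGap_ge (a := exp (-20)) (b := 0.499) (exp_pos _)
    (by norm_num)
  refine ⟨min (1 / 4) (g / 2), max 0 (4 * log (8 / g)), by positivity, fun n r hr hrn => ?_⟩
  have hV : 0 ≤ log (V n r) := log_nonneg (by exact_mod_cast V_pos n r)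
  have hr' : (0 : ℝ) < r := by exact_mod_cast hr
  have hn' : (0 : ℝ) < n := by linarith
  rcases le_total (r * exp 20) (n : ℝ) with h | h
  · have h1 := log_trianglesAtZero_le_of_small hr h
    have h2 := mul_le_mul_of_nonneg_right (min_le_left (1 / 4) (g / 2)) hV
    linarith [le_max_left 0 (4 * log (8 / g))]
  · have h2 : 2 * r < n := by
      have : (2 * r : ℝ) < n := by linarith
      exact_mod_cast this
    have h1 := log_trianglesAtZero_le_entropyGap hr h2
    have h3 := hgap (r / n) ⟨by
      rw [exp_neg, le_div_iff₀ hn', inv_mul_le_iff₀ (exp_pos _)]; linarith, by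
      rw [div_le_iff₀ hn']; exact hrn⟩
    have h4 := mul_le_mul_of_nonneg_left h3 hn'.le
    -- Half of the gain `g * n` absorbs `4 * log n + 4`, up to a constant; the other half is at
    -- least `g / 2 * log V`.
    have h5 := log_le_sub_one_of_pos (x := g * n / 8) (by positivity)
    have h6 : log (n : ℝ) = log (g * n / 8) + log (8 / g) := by
      rw [← log_mul (by positivity) (by positivity)]
      congr 1
      field_simp
    have h7 : log (V n r) ≤ n := by
      have : (V n r : ℝ) ≤ 2 ^ n := by exact_mod_cast V_le_two_pow (by omega)
      have := log_le_log (by exact_mod_cast V_pos n r) this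
      rw [log_pow] at this
      have l2 : log 2 ≤ 1 := by
        have := log_le_sub_one_of_pos (x := 2) two_pos
        linarith
      nlinarith
    have h8 := mul_le_mul_of_nonneg_right (min_le_right (1 / 4) (g / 2)) hV
    have h9 : g / 2 * log (V n r) ≤ g / 2 * n := by gcongr
    linarith [le_max_right 0 (4 * log (8 / g))]

end BinaryCode

/-! ### Conclusion -/

theorem mainTheorem1 :
    ∃ c : ℝ, 0 < c ∧
      ∀ n d : ℕ, 0 < n → 0 < d → (d : ℝ) / (n : ℝ) ≤ 0.499 →
        (BinaryCode.A₂ n d : ℝ) ≥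
          c * ((2 : ℝ) ^ n / (BinaryCode.V n (d - 1) : ℝ)) *
            Real.logb 2 (BinaryCode.V n (d - 1) : ℝ) := by
  open BinaryCode Real in
  obtain ⟨e, C, he, hexp⟩ := exists_triangle_exponent
  set K : ℝ := max 0 (C / 2) + 1 with hK
  have hK1 : 1 ≤ K := by linarith [le_max_left 0 (C / 2)]
  have hKC : C / 2 + 1 ≤ K := by linarith [le_max_right 0 (C / 2)]
  have l2 : 0 < log 2 := log_pos one_lt_two
  refine ⟨log 2 * min (e / (4 * K)) (e / 48), by positivity, fun n d hn hd hdn => ?_⟩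
  obtain ⟨r, rfl⟩ : ∃ r, d = r + 1 := ⟨d - 1, by omega⟩
  rw [Nat.add_sub_cancel, ge_iff_le]
  have hn' : (0 : ℝ) < n := by exact_mod_cast hn
  have hV : (0 : ℝ) < V n r := by exact_mod_cast V_pos n r
  have hlV : 0 ≤ log (V n r) := log_nonneg (by exact_mod_cast V_pos n r)
  suffices h : min (e / (4 * K)) (e / 48) * log (V n r) * 2 ^ n ≤ V n r * A₂ n (r + 1) by
    calc log 2 * min (e / (4 * K)) (e / 48) * (2 ^ n / (V n r : ℝ)) * logb 2 (V n r)
        = min (e / (4 * K)) (e / 48) * log (V n r) * 2 ^ n / V n r := by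
          rw [logb]; field_simp
      _ ≤ A₂ n (r + 1) := by rw [div_le_iff₀ hV]; linarith
  rcases Nat.eq_zero_or_pos r with rfl | hr
  · simp [V]
  have hGV : (2 : ℝ) ^ n ≤ V n r * A₂ n (r + 1) := by
    have := two_pow_le_A₂_mul_V n r
    rw [mul_comm]
    exact_mod_cast this
  have hrn : (r : ℝ) ≤ 0.499 * n := by
    rw [div_le_iff₀ hn'] at hdn
    push_cast at hdn
    linarith
  -- When `log V` is bounded, Gilbert–Varshamov suffices. Otherwise `m = e / 24 * log V` is
  -- admissible: `6 * m` uses half of the saving `e / 2 * log V`, and the other half covers `C / 2 +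
  -- 1`.
  rcases le_total (e / 4 * log (V n r)) K with hsmall | hlarge
  · have h1 : min (e / (4 * K)) (e / 48) * log (V n r) ≤ 1 := by
      calc min (e / (4 * K)) (e / 48) * log (V n r) ≤ e / (4 * K) * log (V n r) := by
            gcongr; exact min_le_left _ _
        _ = e / 4 * log (V n r) / K := by field_simp
        _ ≤ 1 := (div_le_one (by linarith)).2 hsmall
    calc _ ≤ 1 * (2 : ℝ) ^ n := by gcongr
      _ ≤ _ := by rw [one_mul]; exact hGV
  · have hT : (0 : ℝ) < trianglesAtZero n r := by exact_mod_cast trianglesAtZero_pos n r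
    have hm : Real.exp (6 * (e / 24 * log (V n r)) + 1) * √(trianglesAtZero n r) ≤ V n r := by
      rw [← log_le_log_iff (by positivity) hV, log_mul (exp_ne_zero _) (by positivity), log_exp,
        log_sqrt hT.le]
      linarith [hexp n r hr hrn]
    have h1 := A₂_ge_of_triangles n r (m := e / 24 * log (V n r)) (by positivity) hm
    have h2 : min (e / (4 * K)) (e / 48) * log (V n r) * 2 ^ n ≤ e / 48 * log (V n r) * 2 ^ n := by
      gcongr; exact min_le_right _ _
    linarith
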